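/- Let $\Lambda$ be the ring of symmetric functions over $\mathbb{Q}$ in countably many variables $x_1,x_2,\dots$ (formal power series of bounded degree that are invariant under permutations of the variables). For $n\ge 1$ let $p_n=\sum_i x_i^n$ be the power sums, so that $\Lambda=\mathbb{Q}[p_1,p_2,\dots]$, and let $\partial/\partial p_n$ denote the corresponding derivations of $\Lambda$. Let $h_m=\sum_{i_1\le\cdots\le i_m}x_{i_1}\cdots x_{i_m}$ be the complete homogeneous symmetric functions for $m\ge 0$, with $h_0=1$, and let $h_m=0$ for $m<0$. Define linear operators $Y_n:\Lambda\to\Lambda$, $n\in\mathbb{Z}$, as the components of the vertex operator $$Y(z)=\exp\Big(\sum_{n\ge 1}\frac{p_n}{n}z^n\Big)\exp\Big(-\sum_{n\ge 1}\frac{\partial}{\partial p_n}\,(z^{-n}+z^{n})\Big)=\sum_{n\in\mathbb{Z}}Y_n z^{-n},$$ where $p_n$ acts by multiplication. **Theorem.** Let $k\ge 1$ and let $\lambda=(\lambda_1\ge\lambda_2\ge\cdots\ge\lambda_k\ge 0)$ be a partition, written with $k$ entries, where zero entries are allowed. Then $$Y_{-\lambda_1}Y_{-\lambda_2}\cdots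 Y_{-\lambda_k}.1 \;=\; sp_\lambda ,$$ where $sp_\lambda$ is the symplectic Schur function $$sp_\lambda=\tfrac12\det\big(h_{\lambda_i-i+j}+h_{\lambda_i-i-j+2}\big)_{1\le i,j\le k}.$$ -/

import Mathlib

namespace SymmFun

/-- The ring `Λ` of symmetric functions over `ℚ` in the countably many variables
`x₀, x₁, x₂, …`: formal power series of bounded degree that are invariant under every
permutation of the variables. -/
def SymmRing : Subalgebra ℚ (MvPowerSeries ℕ ℚ) where
  carrier := {f | (∀ (σ : Equiv.Perm ℕ) (m : ℕ →₀ ℕ),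
      MvPowerSeries.coeff (m.mapDomain σ) f = MvPowerSeries.coeff m f) ∧
    ∃ d : ℕ, ∀ m : ℕ →₀ ℕ, MvPowerSeries.coeff m f ≠ 0 → m.degree ≤ d}
  mul_mem' := by
    classical
    rintro f g ⟨hf, d, hd⟩ ⟨hg, e, he⟩
    refine ⟨fun σ m => ?_, d + e, fun m hm => ?_⟩
    · rw [MvPowerSeries.coeff_mul, MvPowerSeries.coeff_mul]
      have key : ∀ (τ : Equiv.Perm ℕ) (u v : ℕ →₀ ℕ), (u + v).mapDomain τ =
          u.mapDomain τ + v.mapDomain τ := fun τ u v => Finsupp.mapDomain_add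
      have inv : ∀ (u : ℕ →₀ ℕ), (u.mapDomain σ).mapDomain σ.symm = u := by
        intro u
        rw [← Finsupp.mapDomain_comp]
        simp
      have inv' : ∀ (u : ℕ →₀ ℕ), (u.mapDomain σ.symm).mapDomain σ = u := by
        intro u
        rw [← Finsupp.mapDomain_comp]
        simp
      symm
      refine Finset.sum_nbij' (fun p => (p.1.mapDomain σ, p.2.mapDomain σ))
        (fun p => (p.1.mapDomain σ.symm, p.2.mapDomain σ.symm)) ?_ ?_ ?_ ?_ ?_
      · rintro ⟨u, v⟩ h
        rw [Finset.HasAntidiagonal.mem_antidiagonal] at h ⊢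
        simp only [← h, key]
      · rintro ⟨u, v⟩ h
        rw [Finset.HasAntidiagonal.mem_antidiagonal] at h ⊢
        simp only at h ⊢
        rw [← key, h, inv]
      · rintro ⟨u, v⟩ _
        simp only [inv]
      · rintro ⟨u, v⟩ _
        simp only [inv']
      · rintro ⟨u, v⟩ _
        simp only [hf, hg]
    · rw [MvPowerSeries.coeff_mul] at hm
      obtain ⟨⟨u, v⟩, huv, h⟩ := Finset.exists_ne_zero_of_sum_ne_zero hm
      rw [Finset.HasAntidiagonal.mem_antidiagonal] at huv
      rw [← huv, map_add]
      exact add_le_add (hd _ (left_ne_zero_of_mul h)) (he _ (right_ne_zero_of_mul h))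
  add_mem' := by
    rintro f g ⟨hf, d, hd⟩ ⟨hg, e, he⟩
    refine ⟨fun σ m => by rw [map_add, map_add, hf, hg], max d e, fun m hm => ?_⟩
    by_cases h : MvPowerSeries.coeff m f = 0
    · refine le_max_of_le_right (he m fun h' => hm ?_)
      rw [map_add, h, h', add_zero]
    · exact le_max_of_le_left (hd m h)
  algebraMap_mem' := by
    classical
    intro r
    refine ⟨fun σ m => ?_, 0, fun m hm => ?_⟩
    · rw [MvPowerSeries.algebraMap_apply, MvPowerSeries.coeff_C, MvPowerSeries.coeff_C]
      have : m.mapDomain σ = 0 ↔ m = 0 :=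
        ⟨fun h => Finsupp.mapDomain_injective σ.injective (by rw [h, Finsupp.mapDomain_zero]),
          fun h => by rw [h, Finsupp.mapDomain_zero]⟩
      simp only [this]
    · rw [MvPowerSeries.algebraMap_apply, MvPowerSeries.coeff_C] at hm
      have : m = 0 := by by_contra h; exact hm (if_neg h)
      simp [this]

open Classical in
/-- The power series `∑ i, x_i ^ n` (used for `n ≥ 1`): its monomials are the `x_i ^ n`,
each with coefficient one. -/
noncomputable def powerSumSeries (n : ℕ) : MvPowerSeries ℕ ℚ :=
  fun m => if ∃ i : ℕ, m = Finsupp.single i n then 1 else 0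

open Classical in
theorem coeff_powerSumSeries (n : ℕ) (m : ℕ →₀ ℕ) :
    MvPowerSeries.coeff m (powerSumSeries n) =
      if ∃ i : ℕ, m = Finsupp.single i n then 1 else 0 := rfl

/-- The power series `∑ x_{i₁} ⋯ x_{i_k}` over `i₁ ≤ ⋯ ≤ i_k`: every monomial of degree `k`
occurs with coefficient one. It is `1` for `k = 0` and `0` for `k < 0`. -/
noncomputable def hsymmSeries (k : ℤ) : MvPowerSeries ℕ ℚ :=
  fun m => if (m.degree : ℤ) = k then 1 else 0

theorem coeff_hsymmSeries (k : ℤ) (m : ℕ →₀ ℕ) :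
    MvPowerSeries.coeff m (hsymmSeries k) = if (m.degree : ℤ) = k then 1 else 0 := rfl

open Classical in
/-- The power sum symmetric function `p_n`, `n ≥ 1`. -/
noncomputable def p (n : ℕ+) : SymmRing :=
  ⟨powerSumSeries n, by
    refine ⟨fun σ m => ?_, n, fun m hm => ?_⟩
    · have : (∃ i : ℕ, m.mapDomain σ = Finsupp.single i (n : ℕ)) ↔
          ∃ i : ℕ, m = Finsupp.single i (n : ℕ) := by
        constructor
        · rintro ⟨i, hi⟩
          refine ⟨σ.symm i, Finsupp.mapDomain_injective σ.injective ?_⟩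
          rw [hi, Finsupp.mapDomain_single, Equiv.apply_symm_apply]
        · rintro ⟨i, rfl⟩
          exact ⟨σ i, by rw [Finsupp.mapDomain_single]⟩
      exact if_congr this rfl rfl
    · rw [coeff_powerSumSeries] at hm
      by_cases h : ∃ i : ℕ, m = Finsupp.single i (n : ℕ)
      · obtain ⟨i, rfl⟩ := h
        simp
      · exact absurd (if_neg h) hm⟩

/-- The complete homogeneous symmetric function `h_k`, with `h_k = 0` for `k < 0`. -/
noncomputable def h (k : ℤ) : SymmRing :=
  ⟨hsymmSeries k, by
    refine ⟨fun σ m => ?_, k.toNat, fun m hm => ?_⟩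
    · have : (m.mapDomain σ).degree = m.degree := by simp
      simp only [coeff_hsymmSeries, this]
    · rw [coeff_hsymmSeries] at hm
      by_cases h : (m.degree : ℤ) = k
      · omega
      · exact absurd (if_neg h) hm⟩

/-- The multiset of the nonzero exponents of a monomial. -/
def expType (m : ℕ →₀ ℕ) : Multiset ℕ+ :=
  m.support.val.map fun i => (m i).toPNat'

theorem expType_single_add {i : ℕ} {n : ℕ+} {b : ℕ →₀ ℕ} (hi : b i = 0) :
    expType (Finsupp.single i (n : ℕ) + b) = n ::ₘ expType b := by
  classical
  have hs : (Finsupp.single i (n : ℕ) + b).support = insert i b.support := by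
    ext j
    by_cases hj : j = i
    · subst hj; simp
    · simp [hj]
  have hi' : i ∉ b.support := by simpa using hi
  rw [expType, hs, Finset.insert_val_of_notMem hi', Multiset.map_cons, expType]
  congr 1
  · simp [hi]
  · refine Multiset.map_congr rfl fun j hj => ?_
    have : i ≠ j := by rintro rfl; exact hi' hj
    simp [this]

theorem exists_of_expType_cons {m : ℕ →₀ ℕ} {n : ℕ+} {s : Multiset ℕ+}
    (hm : expType m = n ::ₘ s) :
    ∃ (i : ℕ) (b : ℕ →₀ ℕ), m = Finsupp.single i (n : ℕ) + b ∧ b i = 0 ∧ expType b = s := by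
  have hn : n ∈ expType m := by simp [hm]
  obtain ⟨i, hi, hin⟩ := Multiset.mem_map.1 hn
  have hi0 : m i ≠ 0 := by simpa using hi
  have hmi : m i = n := by
    rw [← hin, Nat.toPNat'_coe, if_pos (Nat.pos_of_ne_zero hi0)]
  have e : m = Finsupp.single i (n : ℕ) + m.erase i := by
    rw [← hmi, Finsupp.single_add_erase]
  have hb : (m.erase i) i = 0 := Finsupp.erase_same
  refine ⟨i, m.erase i, e, hb, ?_⟩
  rw [e, expType_single_add hb] at hm
  exact (Multiset.cons_inj_right n).1 hm

theorem expType_eq_zero {m : ℕ →₀ ℕ} (hm : expType m = 0) : m = 0 := by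
  rw [expType, Multiset.map_eq_zero] at hm
  simpa using hm

theorem exists_expType (s : Multiset ℕ+) : ∃ m, expType m = s := by
  induction s using Multiset.induction_on with
  | empty => exact ⟨0, rfl⟩
  | cons n s ih =>
    obtain ⟨m, hm⟩ := ih
    obtain ⟨i, hi⟩ := Infinite.exists_notMem_finset m.support
    exact ⟨Finsupp.single i (n : ℕ) + m, by rw [expType_single_add (by simpa using hi), hm]⟩

theorem exists_perm_of_expType (s : Multiset ℕ+) : ∀ m m' : ℕ →₀ ℕ, expType m = s →
    expType m' = s → ∃ σ : Equiv.Perm ℕ, m.mapDomain σ = m' := by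
  induction s using Multiset.induction_on with
  | empty =>
    intro m m' hm hm'
    exact ⟨1, by rw [expType_eq_zero hm, expType_eq_zero hm', Finsupp.mapDomain_zero]⟩
  | cons n s ih =>
    intro m m' hm hm'
    obtain ⟨i, b, rfl, hb, hbs⟩ := exists_of_expType_cons hm
    obtain ⟨j, c, rfl, hc, hcs⟩ := exists_of_expType_cons hm'
    obtain ⟨σ, hσ⟩ := ih b c hbs hcs
    refine ⟨Equiv.swap (σ i) j * σ, ?_⟩
    rw [Finsupp.mapDomain_add, Finsupp.mapDomain_single]
    congr 1
    · simp
    · have h1 : c (σ i) = 0 := by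
        rw [← hσ, Finsupp.mapDomain_apply σ.injective, hb]
      rw [Equiv.Perm.coe_mul, Finsupp.mapDomain_comp, hσ]
      conv_rhs => rw [← Finsupp.mapDomain_id (v := c)]
      refine Finsupp.mapDomain_congr fun x hx => ?_
      have hx' : c x ≠ 0 := by simpa using hx
      rw [Equiv.swap_apply_of_ne_of_ne]
      · rfl
      · rintro rfl; exact hx' h1
      · rintro rfl; exact hx' hc

theorem coeff_eq_of_expType {f : MvPowerSeries ℕ ℚ} (hf : f ∈ SymmRing) {m m' : ℕ →₀ ℕ}
    (hm : expType m = expType m') : MvPowerSeries.coeff m f = MvPowerSeries.coeff m' f := by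
  obtain ⟨σ, rfl⟩ := exists_perm_of_expType _ m m' rfl hm.symm
  exact (hf.1 σ m).symm

/-- The product of the power sums indexed by a multiset, as a power series. -/
noncomputable def pProd (s : Multiset ℕ+) : MvPowerSeries ℕ ℚ :=
  (((s.map p).prod : SymmRing) : MvPowerSeries ℕ ℚ)

theorem pProd_cons (n : ℕ+) (s : Multiset ℕ+) : pProd (n ::ₘ s) = (p n).1 * pProd s := by
  simp [pProd]

theorem coeff_p_nonneg (n : ℕ+) (m : ℕ →₀ ℕ) : 0 ≤ MvPowerSeries.coeff m (p n).1 := by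
  classical
  rw [p, coeff_powerSumSeries]
  split_ifs <;> simp

theorem coeff_pProd_nonneg (s : Multiset ℕ+) (m : ℕ →₀ ℕ) :
    0 ≤ MvPowerSeries.coeff m (pProd s) := by
  classical
  induction s using Multiset.induction_on generalizing m with
  | empty =>
    simp only [pProd, Multiset.map_zero, Multiset.prod_zero, OneMemClass.coe_one,
      MvPowerSeries.coeff_one]
    split_ifs <;> simp
  | cons n s ih =>
    rw [pProd_cons, MvPowerSeries.coeff_mul]
    exact Finset.sum_nonneg fun x _ => mul_nonneg (coeff_p_nonneg _ _) (ih _)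

theorem coeff_pProd_ne_zero (s : Multiset ℕ+) (m : ℕ →₀ ℕ)
    (hm : MvPowerSeries.coeff m (pProd s) ≠ 0) :
    Multiset.card (expType m) ≤ Multiset.card s ∧
      (Multiset.card (expType m) = Multiset.card s → expType m = s) := by
  classical
  induction s using Multiset.induction_on generalizing m with
  | empty =>
    have : m = 0 := by
      by_contra h
      apply hm
      simp [pProd, MvPowerSeries.coeff_one, h]
    subst this
    exact ⟨le_rfl, fun _ => rfl⟩
  | cons n s ih =>
    rw [pProd_cons, MvPowerSeries.coeff_mul] at hm
    obtain ⟨⟨u, v⟩, huv, hne⟩ := Finset.exists_ne_zero_of_sum_ne_zero hm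
    rw [Finset.HasAntidiagonal.mem_antidiagonal] at huv
    simp only at huv hne
    obtain ⟨i, rfl⟩ : ∃ i, u = Finsupp.single i (n : ℕ) := by
      by_contra h
      exact left_ne_zero_of_mul hne (if_neg h)
    obtain ⟨h1, h2⟩ := ih v (right_ne_zero_of_mul hne)
    subst huv
    by_cases hi : v i = 0
    · rw [expType_single_add hi, Multiset.card_cons, Multiset.card_cons]
      exact ⟨by omega, fun h => by rw [h2 (by omega)]⟩
    · have hs : (Finsupp.single i (n : ℕ) + v).support = v.support := by
        ext j
        by_cases hj : j = i
        · subst hj; simp [hi]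
        · simp [hj]
      have : Multiset.card (expType (Finsupp.single i (n : ℕ) + v)) =
          Multiset.card (expType v) := by
        simp only [expType, Multiset.card_map, hs]
      rw [this, Multiset.card_cons]
      exact ⟨by omega, fun h => by omega⟩

theorem coeff_pProd_pos (s : Multiset ℕ+) (m : ℕ →₀ ℕ) (hm : expType m = s) :
    0 < MvPowerSeries.coeff m (pProd s) := by
  classical
  induction s using Multiset.induction_on generalizing m with
  | empty =>
    rw [expType_eq_zero hm]
    simp [pProd]
  | cons n s ih =>
    obtain ⟨i, b, rfl, hb, hbs⟩ := exists_of_expType_cons hm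
    rw [pProd_cons, MvPowerSeries.coeff_mul]
    refine Finset.sum_pos' (fun x _ => mul_nonneg (coeff_p_nonneg _ _) (coeff_pProd_nonneg _ _))
      ⟨(Finsupp.single i (n : ℕ), b), by simp, mul_pos ?_ (ih b hbs)⟩
    have : MvPowerSeries.coeff (Finsupp.single i (n : ℕ)) (p n).1 = 1 := if_pos ⟨i, rfl⟩
    rw [this]
    exact one_pos

/-- The homomorphism `ℚ[X₁, X₂, …] → Λ` sending `X_n` to the power sum `p_n`. -/
noncomputable def ofPowerSums : MvPolynomial ℕ+ ℚ →ₐ[ℚ] SymmRing := MvPolynomial.aeval p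

theorem ofPowerSums_monomial (ν : ℕ+ →₀ ℕ) (c : ℚ) :
    (ofPowerSums (MvPolynomial.monomial ν c) : MvPowerSeries ℕ ℚ) =
      c • pProd (Finsupp.toMultiset ν) := by
  rw [ofPowerSums, MvPolynomial.aeval_monomial, pProd, ← Algebra.smul_def,
    Finsupp.toMultiset_map, Finsupp.prod_toMultiset, Finsupp.prod_mapDomain_index]
  · rfl
  · simp
  · intro b a c; exact pow_add _ _ _

theorem ofPowerSums_injective : Function.Injective ofPowerSums := by
  rw [injective_iff_map_eq_zero]
  intro g hg
  by_contra hne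
  have hsupp : g.support.Nonempty := by
    rwa [Finset.nonempty_iff_ne_empty, Ne, MvPolynomial.support_eq_empty]
  obtain ⟨ν, hν, hmax⟩ := Finset.exists_max_image g.support
    (fun ν => Multiset.card (Finsupp.toMultiset ν)) hsupp
  obtain ⟨m, hm⟩ := exists_expType (Finsupp.toMultiset ν)
  have h0 : MvPowerSeries.coeff m (ofPowerSums g).1 = 0 := by rw [hg]; rfl
  have hexp : (ofPowerSums g).1 =
      ∑ μ ∈ g.support, MvPolynomial.coeff μ g • pProd (Finsupp.toMultiset μ) := by
    conv_lhs => rw [MvPolynomial.as_sum g, map_sum]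
    rw [AddSubmonoidClass.coe_finsetSum]
    exact Finset.sum_congr rfl fun μ _ => ofPowerSums_monomial μ _
  rw [hexp, map_sum, Finset.sum_eq_single ν] at h0
  · rw [map_smul, smul_eq_mul] at h0
    rcases mul_eq_zero.1 h0 with h | h
    · exact (MvPolynomial.mem_support_iff.1 hν) h
    · exact (coeff_pProd_pos _ m hm).ne' h
  · intro μ hμ hμν
    rw [map_smul, smul_eq_mul]
    by_contra h
    obtain ⟨h1, h2⟩ := coeff_pProd_ne_zero _ _ (right_ne_zero_of_mul h)
    rw [hm] at h1 h2
    exact hμν (Multiset.toFinsupp.symm.injective (h2 (le_antisymm h1 (hmax μ hμ))).symm)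
  · exact fun h => absurd hν h

theorem pProd_mem_range (s : Multiset ℕ+) :
    ∃ g : MvPolynomial ℕ+ ℚ, (ofPowerSums g).1 = pProd s := by
  refine ⟨MvPolynomial.monomial (Multiset.toFinsupp s) 1, ?_⟩
  rw [ofPowerSums_monomial, one_smul, Multiset.toFinsupp_toMultiset]

theorem mem_range_of_card_lt (L : ℕ) : ∀ f : SymmRing,
    (∀ m, MvPowerSeries.coeff m f.1 ≠ 0 → Multiset.card (expType m) < L) →
    f ∈ ofPowerSums.range := by
  classical
  induction L with
  | zero =>
    intro f hf
    have : f = 0 := by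
      apply Subtype.ext
      ext m
      by_contra h
      exact absurd (hf m h) (by omega)
    rw [this]
    exact zero_mem _
  | succ L ih =>
    intro f hf
    obtain ⟨d, hd⟩ := f.2.2
    choose r hr using exists_expType
    choose q hq using pProd_mem_range
    let S : Finset (Multiset ℕ+) :=
      ((Finset.Iic d.succPNat).sym L).map ⟨fun t : Sym ℕ+ L => t.1, Subtype.val_injective⟩
    have hS : ∀ s ∈ S, Multiset.card s = L := by
      intro s hs
      obtain ⟨t, -, rfl⟩ := Finset.mem_map.1 hs
      exact t.2
    let c : Multiset ℕ+ → ℚ := fun s =>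
      MvPowerSeries.coeff (r s) f.1 / MvPowerSeries.coeff (r s) (pProd s)
    let g : MvPolynomial ℕ+ ℚ := ∑ s ∈ S, c s • q s
    have hg : (ofPowerSums g).1 = ∑ s ∈ S, c s • pProd s := by
      simp only [g, map_sum, map_smul]
      rw [AddSubmonoidClass.coe_finsetSum]
      exact Finset.sum_congr rfl fun s _ => by rw [← hq s]; rfl
    have hfg : f - ofPowerSums g ∈ ofPowerSums.range := by
      refine ih _ fun m hm => ?_
      have hm' : MvPowerSeries.coeff m f.1 -
          ∑ s ∈ S, c s * MvPowerSeries.coeff m (pProd s) ≠ 0 := by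
        intro h0
        apply hm
        have : (f - ofPowerSums g).1 = f.1 - (ofPowerSums g).1 := rfl
        rw [this, hg, map_sub, map_sum, ← h0]
        simp
      by_contra hlt
      apply hm'
      rcases lt_or_eq_of_le (not_lt.1 hlt) with hL | hL
      · have h1 : MvPowerSeries.coeff m f.1 = 0 := by
          by_contra h
          have := hf m h
          omega
        rw [h1, Finset.sum_eq_zero, sub_zero]
        intro s hs
        by_contra h
        have := (coeff_pProd_ne_zero _ _ (right_ne_zero_of_mul h)).1
        rw [hS s hs] at this
        omega
      · have hz : ∀ s ∈ S, s ≠ expType m → c s * MvPowerSeries.coeff m (pProd s) = 0 := by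
          intro s hs hne
          by_contra h
          exact hne ((coeff_pProd_ne_zero _ _ (right_ne_zero_of_mul h)).2
            (by rw [hS s hs, hL])).symm
        have hval : MvPowerSeries.coeff m f.1 =
            c (expType m) * MvPowerSeries.coeff m (pProd (expType m)) := by
          have e1 := coeff_eq_of_expType f.2 (hr (expType m))
          have e2 := coeff_eq_of_expType (f := pProd (expType m)) (Subtype.property _)
            (hr (expType m))
          simp only [c]
          rw [e1, e2, div_mul_cancel₀ _ (coeff_pProd_pos _ m rfl).ne']
        rw [Finset.sum_eq_single (expType m) (fun s hs hne => hz s hs hne), hval, sub_self]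
        intro hnot
        rw [← hval]
        by_contra h
        refine hnot (Finset.mem_map.2 ⟨Sym.mk (expType m) hL.symm,
          Finset.mem_sym_iff.2 fun a ha => ?_, rfl⟩)
        obtain ⟨i, hi, rfl⟩ := Multiset.mem_map.1 (show a ∈ expType m from ha)
        have hi0 : m i ≠ 0 := by simpa using hi
        have := (Finsupp.le_degree i m).trans (hd m h)
        rw [Finset.mem_Iic, ← PNat.coe_le_coe, Nat.toPNat'_coe,
          if_pos (Nat.pos_of_ne_zero hi0), Nat.succPNat_coe]
        omega
    have := add_mem hfg (AlgHom.mem_range_self ofPowerSums g)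
    rwa [sub_add_cancel] at this

theorem ofPowerSums_bijective : Function.Bijective ofPowerSums := by
  refine ⟨ofPowerSums_injective, fun f => ?_⟩
  obtain ⟨d, hd⟩ := f.2.2
  refine mem_range_of_card_lt (d + 1) f fun m hm => ?_
  have h1 : Multiset.card (expType m) = m.support.card := by simp [expType]
  have h2 : m.support.card ≤ m.degree := by
    rw [Finset.card_eq_sum_ones, Finsupp.degree_apply]
    refine Finset.sum_le_sum fun i hi => ?_
    have : m i ≠ 0 := by simpa using hi
    omega
  have := hd m hm
  omega

/-- `Λ` is the polynomial ring over `ℚ` in the power sums `p₁, p₂, …`. -/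
noncomputable def powerSumEquiv : MvPolynomial ℕ+ ℚ ≃ₐ[ℚ] SymmRing :=
  AlgEquiv.ofBijective ofPowerSums ofPowerSums_bijective

theorem powerSumEquiv_X (n : ℕ+) : powerSumEquiv (MvPolynomial.X n) = p n := by
  simp [powerSumEquiv, ofPowerSums]

/-- The derivation `∂/∂p_n` of `Λ = ℚ[p₁, p₂, …]`. -/
noncomputable def pDeriv (n : ℕ+) : Derivation ℚ SymmRing SymmRing :=
  Derivation.mk' (powerSumEquiv.toLinearMap ∘ₗ (MvPolynomial.pderiv n).toLinearMap ∘ₗ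
    powerSumEquiv.symm.toLinearMap) fun a b => by simp

theorem pDeriv_apply (n : ℕ+) (f : SymmRing) : pDeriv n f =
    powerSumEquiv (MvPolynomial.pderiv n (powerSumEquiv.symm f)) := rfl

theorem pDeriv_p (n m : ℕ+) : pDeriv n (p m) = if n = m then 1 else 0 := by
  classical
  rw [pDeriv_apply, ← powerSumEquiv_X, AlgEquiv.symm_apply_apply, MvPolynomial.pderiv_X,
    Pi.single_apply]
  by_cases hnm : n = m
  · simp [hnm]
  · simp [hnm, Ne.symm hnm]

open LaurentPolynomial

section LocallyFinite

variable {ι V : Type*} [AddCommMonoid V] [Module ℚ V]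

/-- The pointwise sum `∑ i, A i` of a locally finite family of linear operators: for every
vector only finitely many of the operators do not kill it. -/
noncomputable def locallyFiniteSum (A : ι → Module.End ℚ V)
    (hA : ∀ v, {i | A i v ≠ 0}.Finite) : Module.End ℚ V where
  toFun v := ∑ᶠ i, A i v
  map_add' u v := by
    simp only [map_add]
    exact finsum_add_distrib (hA u) (hA v)
  map_smul' c v := by
    simp only [map_smul, RingHom.id_apply]
    exact (smul_finsum' c (hA v)).symm

end LocallyFinite

/-- `∂/∂p_n` acting coefficientwise on Laurent polynomials over `Λ`. -/
noncomputable def pDerivLaurent (n : ℕ+) : Module.End ℚ SymmRing[T;T⁻¹] where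
  toFun F := AddMonoidAlgebra.map ((pDeriv n : SymmRing →ₗ[ℚ] SymmRing) : SymmRing →+ SymmRing) F
  map_add' F G := by ext; simp
  map_smul' c F := by ext; simp

theorem pDerivLaurent_coeff (n : ℕ+) (F : SymmRing[T;T⁻¹]) (k : ℤ) :
    (pDerivLaurent n F).coeff k = pDeriv n (F.coeff k) := by
  simp [pDerivLaurent]

/-- The operator `-(z⁻ⁿ + zⁿ) ∂/∂p_n` on Laurent polynomials in `z` over `Λ`. -/
noncomputable def annihTerm (n : ℕ+) : Module.End ℚ SymmRing[T;T⁻¹] :=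
  LinearMap.mulLeft ℚ (-(T (-(n : ℤ)) + T (n : ℤ))) ∘ₗ pDerivLaurent n

theorem annihTerm_coeff (n : ℕ+) (F : SymmRing[T;T⁻¹]) (k : ℤ) :
    (annihTerm n F).coeff k =
      -(pDeriv n (F.coeff (k + n)) + pDeriv n (F.coeff (k - n))) := by
  have key : ∀ (m : ℤ) (G : SymmRing[T;T⁻¹]), (T m * G).coeff k = G.coeff (k - m) := by
    intro m G
    rw [T, AddMonoidAlgebra.coeff_single_mul_apply, one_mul, neg_add_eq_sub]
  have e : annihTerm n F =
      -(T (-(n : ℤ)) * pDerivLaurent n F + T (n : ℤ) * pDerivLaurent n F) := by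
    rw [annihTerm, LinearMap.comp_apply, LinearMap.mulLeft_apply]
    ring
  rw [e, AddMonoidAlgebra.coeff_neg, AddMonoidAlgebra.coeff_add, Finsupp.neg_apply,
    Finsupp.add_apply, key, key, pDerivLaurent_coeff, pDerivLaurent_coeff, sub_neg_eq_add]

theorem pDerivLaurent_finite (F : SymmRing[T;T⁻¹]) : {n | pDerivLaurent n F ≠ 0}.Finite := by
  classical
  refine (F.coeff.support.biUnion fun k =>
    (powerSumEquiv.symm (F.coeff k)).vars).finite_toSet.subset fun n hn => ?_
  by_contra hnot
  apply hn
  ext1 k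
  rw [pDerivLaurent_coeff]
  by_cases hk : F.coeff k = 0
  · simp [hk]
  · rw [pDeriv_apply, MvPolynomial.pderiv_eq_zero_of_notMem_vars, map_zero]
    · rfl
    · intro hmem
      exact hnot (Finset.mem_coe.2 (Finset.mem_biUnion.2 ⟨k, by simpa using hk, hmem⟩))

theorem annihTerm_finite (F : SymmRing[T;T⁻¹]) : {n | annihTerm n F ≠ 0}.Finite := by
  refine (pDerivLaurent_finite F).subset fun n hn h => hn ?_
  rw [annihTerm, LinearMap.comp_apply, h, map_zero]

/-- The operator `-∑_{n ≥ 1} (z⁻ⁿ + zⁿ) ∂/∂p_n`. -/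
noncomputable def annihSum : Module.End ℚ SymmRing[T;T⁻¹] :=
  locallyFiniteSum annihTerm annihTerm_finite

/-- The elements of `Λ` which are polynomials of total degree less than `d` in the power sums. -/
def degreeLT (d : ℕ) : Submodule ℚ SymmRing where
  carrier := {f | ∀ ν ∈ (powerSumEquiv.symm f).support, ν.degree < d}
  add_mem' := by
    classical
    intro a b ha hb ν hν
    rw [map_add] at hν
    rcases Finset.mem_union.1 (MvPolynomial.support_add hν) with h | h
    · exact ha ν h
    · exact hb ν h
  zero_mem' := by simp
  smul_mem' := by
    intro c f hf ν hν
    rw [map_smul] at hν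
    exact hf ν (MvPolynomial.support_smul hν)

theorem pDeriv_mem_degreeLT {d : ℕ} {f : SymmRing} (n : ℕ+) (hf : f ∈ degreeLT (d + 1)) :
    pDeriv n f ∈ degreeLT d := by
  intro ν hν
  rw [pDeriv_apply, AlgEquiv.symm_apply_apply, MvPolynomial.mem_support_iff,
    MvPolynomial.coeff_pderiv] at hν
  have := hf _ (MvPolynomial.mem_support_iff.2 (left_ne_zero_of_mul hν))
  rw [map_add, Finsupp.degree_single] at this
  omega

theorem annihSum_pow_eq_zero (d : ℕ) : ∀ F : SymmRing[T;T⁻¹],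
    (∀ k, F.coeff k ∈ degreeLT d) → (annihSum ^ d) F = 0 := by
  induction d with
  | zero =>
    intro F hF
    ext1 k
    have h0 : powerSumEquiv.symm (F.coeff k) = 0 := by
      rw [← MvPolynomial.support_eq_empty, Finset.eq_empty_iff_forall_notMem]
      exact fun ν hν => absurd (hF k ν hν) (by omega)
    simpa using h0
  | succ d ih =>
    intro F hF
    rw [pow_succ, Module.End.mul_apply]
    refine ih _ fun k => ?_
    have e : annihSum F = ∑ n ∈ (annihTerm_finite F).toFinset, annihTerm n F :=
      finsum_eq_sum _ (annihTerm_finite F)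
    rw [e, AddMonoidAlgebra.coeff_sum, Finsupp.finsetSum_apply]
    refine sum_mem fun n _ => ?_
    rw [annihTerm_coeff]
    exact neg_mem (add_mem (pDeriv_mem_degreeLT n (hF _)) (pDeriv_mem_degreeLT n (hF _)))

theorem annihSum_finite (F : SymmRing[T;T⁻¹]) :
    {k : ℕ | ((k.factorial : ℚ)⁻¹ • annihSum ^ k) F ≠ 0}.Finite := by
  classical
  let d := F.coeff.support.sup fun k =>
    (powerSumEquiv.symm (F.coeff k)).support.sup fun ν => ν.degree + 1
  refine (Set.finite_lt_nat d).subset fun k hk => ?_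
  by_contra hlt
  apply hk
  rw [LinearMap.smul_apply, annihSum_pow_eq_zero, smul_zero]
  intro i ν hν
  have hi : i ∈ F.coeff.support := by
    rw [Finsupp.mem_support_iff]
    intro h
    simp [h] at hν
  have h1 : ν.degree + 1 ≤ d :=
    (Finset.le_sup (f := fun ν : ℕ+ →₀ ℕ => ν.degree + 1) hν).trans
      (Finset.le_sup (f := fun k => (powerSumEquiv.symm (F.coeff k)).support.sup
        fun ν => ν.degree + 1) hi)
  have h2 : ¬ k < d := hlt
  omega

/-- The operator `exp(-∑_{n ≥ 1} (z⁻ⁿ + zⁿ) ∂/∂p_n)`. -/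
noncomputable def annihExp : Module.End ℚ SymmRing[T;T⁻¹] :=
  locallyFiniteSum (fun k : ℕ => (k.factorial : ℚ)⁻¹ • annihSum ^ k) annihSum_finite

/-- The power series `∑_{n ≥ 1} (p_n / n) zⁿ` over `Λ`. -/
noncomputable def creationSum : PowerSeries SymmRing :=
  PowerSeries.mk fun n => if hn : 0 < n then (n : ℚ)⁻¹ • p ⟨n, hn⟩ else 0

theorem hasSubst_creationSum : PowerSeries.HasSubst creationSum := by
  refine PowerSeries.HasSubst.of_constantCoeff_zero' ?_
  simp [creationSum, ← PowerSeries.coeff_zero_eq_constantCoeff_apply]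

/-- The power series `exp(∑_{n ≥ 1} (p_n / n) zⁿ)` over `Λ`. -/
noncomputable def creationExp : PowerSeries SymmRing :=
  (PowerSeries.exp ℚ).subst creationSum

/-- The coefficient of `z^j`, `j ∈ ℤ`, in `exp(∑_{n ≥ 1} (p_n / n) zⁿ)`; zero for `j < 0`. -/
noncomputable def creationCoeff (j : ℤ) : SymmRing :=
  if 0 ≤ j then PowerSeries.coeff j.toNat creationExp else 0

/-- The component `Y_n : Λ → Λ`, `n ∈ ℤ`, of the vertex operator
`Y(z) = exp(∑_{n ≥ 1} (p_n / n) zⁿ) exp(-∑_{n ≥ 1} (z⁻ⁿ + zⁿ) ∂/∂p_n) = ∑ Y_n z⁻ⁿ`: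
the coefficient of `z⁻ⁿ` in `Y(z) f`, where the first exponential acts by multiplication. -/
noncomputable def Y (n : ℤ) : Module.End ℚ SymmRing where
  toFun f := (annihExp (C f)).coeff.sum fun m g => creationCoeff (-n - m) * g
  map_add' f g := by
    rw [map_add, map_add, AddMonoidAlgebra.coeff_add]
    exact Finsupp.sum_add_index' (fun _ => mul_zero _) fun _ _ _ => mul_add _ _ _
  map_smul' c f := by
    have h1 : (C (c • f) : SymmRing[T;T⁻¹]) = c • C f := by ext; simp
    rw [h1, map_smul, RingHom.id_apply, AddMonoidAlgebra.coeff_smul,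
      Finsupp.sum_smul_index' fun _ => mul_zero _, Finsupp.smul_sum]
    exact Finsupp.sum_congr fun m _ => mul_smul_comm _ _ _

/-- The symplectic Schur function
`½ det (h_{λ_i - i + j} + h_{λ_i - i - j + 2})`, `1 ≤ i, j ≤ k`, of a partition with `k` rows
(the indices `i, j` of the code start from zero). -/
noncomputable def symplecticSchur {k : ℕ} (lam : Fin k → ℕ) : SymmRing :=
  (1 / 2 : ℚ) • (Matrix.of fun i j : Fin k =>
    h ((lam i : ℤ) - ((i : ℤ) + 1) + ((j : ℤ) + 1)) +
      h ((lam i : ℤ) - ((i : ℤ) + 1) - ((j : ℤ) + 1) + 2)).det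

end SymmFun

/-! The exponent of the annihilation factor is a locally nilpotent derivation, so its exponential is
a ring homomorphism `annihHom` from Λ to Λ[z, z⁻¹]; it sends p_n to p_n - zⁿ - z⁻ⁿ. On H(w) = ∑ h_n
wⁿ = exp(∑ p_n wⁿ/n) it therefore acts as multiplication by (1 - zw)(1 - z⁻¹w), that is, h_k ↦ h_k -
(z + z⁻¹) h_{k-1} + h_{k-2} (`annihHom_h`). The creation factor is H(z) itself (`creationExp_eq`),
so Y_{-a} f is the coefficient of z^a in H(z) · `annihHom` f (`Y_apply`).

Apply this to the determinant of `symplecticMatrix`. The image has the columns v_{j+1} + v_{j-1} -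
(z + z⁻¹) v_j, where the v_j are the columns of the next larger symplectic matrix without its top
row. These combinations annihilate the sequence t_j = z^j + z^{-j}. Hence the image is the larger
determinant with top row (t_j): column operations clear that row apart from t_0 = 2
(`two_mul_det_eq_of_even`, `map_det_symplecticMatrix`). Multiplying by H(z) and taking the
coefficient of z^a turns t_j into h_{a-j} + h_{a+j}, which is the missing top row. So Y_{-a} adds a
row a to the determinant (`Y_det_symplecticMatrix`), and induction on the number of rows finishes.
-/

namespace SymmFun

open LaurentPolynomial

/-! ### Exponentials of locally nilpotent derivations -/

section LocallyNilpotent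

variable {A : Type*} [CommRing A] [Algebra ℚ A]

/-- The polynomial `∑ (Dⁿ a / n!) Xⁿ` attached to a locally nilpotent operator `D`. -/
noncomputable def expPoly (D : Module.End ℚ A)
    (hD : ∀ a, {n : ℕ | ((n.factorial : ℚ)⁻¹ • D ^ n) a ≠ 0}.Finite) (a : A) : Polynomial A :=
  ∑ n ∈ (hD a).toFinset, Polynomial.monomial n (((n.factorial : ℚ)⁻¹ • D ^ n) a)

theorem coeff_expPoly (D : Module.End ℚ A)
    (hD : ∀ a, {n : ℕ | ((n.factorial : ℚ)⁻¹ • D ^ n) a ≠ 0}.Finite) (a : A) (n : ℕ) :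
    (expPoly D hD a).coeff n = ((n.factorial : ℚ)⁻¹ • D ^ n) a := by
  rw [expPoly, Polynomial.finsetSum_coeff]
  simp only [Polynomial.coeff_monomial]
  rw [Finset.sum_ite_eq']
  split_ifs with h
  · rfl
  · symm
    by_contra hne
    exact h ((hD a).mem_toFinset.2 hne)

theorem eval_expPoly (D : Module.End ℚ A)
    (hD : ∀ a, {n : ℕ | ((n.factorial : ℚ)⁻¹ • D ^ n) a ≠ 0}.Finite) (a : A) :
    (expPoly D hD a).eval 1 =
      locallyFiniteSum (fun n : ℕ => (n.factorial : ℚ)⁻¹ • D ^ n) hD a := by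
  rw [expPoly, Polynomial.eval_finsetSum]
  simp only [Polynomial.eval_monomial, one_pow, mul_one]
  exact (finsum_eq_sum _ (hD a)).symm

theorem pow_apply_mul {D : Module.End ℚ A} (hmul : ∀ a b, D (a * b) = a * D b + D a * b)
    (n : ℕ) (a b : A) :
    (D ^ n) (a * b) =
      ∑ x ∈ Finset.HasAntidiagonal.antidiagonal n, (n.choose x.1) • ((D ^ x.1) a * (D ^ x.2) b) := by
  induction n with
  | zero => simp
  | succ n ih =>
    rw [Finset.sum_antidiagonal_choose_succ_nsmul (fun i j => (D ^ i) a * (D ^ j) b) n,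
      pow_succ', Module.End.mul_apply, ih, map_sum, ← Finset.sum_add_distrib]
    refine Finset.sum_congr rfl fun x hx => ?_
    -- The Pascal splitting weights its second sum by `n.choose x.2`, the first by `n.choose x.1`;
    -- symmetry lets the two merge.
    have e : n.choose x.2 = n.choose x.1 := by
      rw [Finset.HasAntidiagonal.mem_antidiagonal] at hx
      exact Nat.choose_symm_of_eq_add (by omega)
    rw [map_nsmul, hmul, e, ← nsmul_add, ← Module.End.mul_apply, ← Module.End.mul_apply,
      ← pow_succ', ← pow_succ']

/-- After division by n!, the iterated Leibniz rule is exactly the Cauchy product of coefficients.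
Working with polynomials reduces multiplicativity of the exponential to evaluation at 1. -/
theorem expPoly_mul {D : Module.End ℚ A} (hmul : ∀ a b, D (a * b) = a * D b + D a * b)
    (hD : ∀ a, {n : ℕ | ((n.factorial : ℚ)⁻¹ • D ^ n) a ≠ 0}.Finite) (a b : A) :
    expPoly D hD (a * b) = expPoly D hD a * expPoly D hD b := by
  ext n
  rw [coeff_expPoly, Polynomial.coeff_mul, LinearMap.smul_apply, pow_apply_mul hmul,
    Finset.smul_sum]
  refine Finset.sum_congr rfl fun x hx => ?_
  rw [Finset.HasAntidiagonal.mem_antidiagonal] at hx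
  rw [coeff_expPoly, coeff_expPoly, LinearMap.smul_apply, LinearMap.smul_apply, smul_mul_smul_comm,
    ← Nat.cast_smul_eq_nsmul ℚ, smul_smul, ← hx, Nat.choose_symm_add, Nat.add_choose, Nat.cast_div]
  · congr 1
    have h1 : ((x.1 + x.2).factorial : ℚ) ≠ 0 := by positivity
    have h2 : (x.1.factorial : ℚ) ≠ 0 := by positivity
    have h3 : (x.2.factorial : ℚ) ≠ 0 := by positivity
    push_cast
    field_simp
  · exact Nat.factorial_mul_factorial_dvd_factorial_add _ _
  · positivity

end LocallyNilpotent

/-! ### The annihilation factor as a ring homomorphism -/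

theorem pDerivLaurent_C_mul_T (n : ℕ+) (f : SymmRing) (k : ℤ) :
    pDerivLaurent n (C f * T k) = C (pDeriv n f) * T k := by
  ext1 j
  rw [pDerivLaurent_coeff, ← single_eq_C_mul_T, ← single_eq_C_mul_T,
    AddMonoidAlgebra.coeff_single, AddMonoidAlgebra.coeff_single, Finsupp.single_apply,
    Finsupp.single_apply]
  split_ifs <;> simp

theorem pDerivLaurent_mul (n : ℕ+) (F G : SymmRing[T;T⁻¹]) :
    pDerivLaurent n (F * G) = F * pDerivLaurent n G + pDerivLaurent n F * G := by
  induction F using LaurentPolynomial.induction_on' with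
  | add F₁ F₂ h₁ h₂ => rw [add_mul, map_add, map_add, h₁, h₂]; ring
  | C_mul_T k f =>
    induction G using LaurentPolynomial.induction_on' with
    | add G₁ G₂ h₁ h₂ => rw [mul_add, map_add, map_add, h₁, h₂]; ring
    | C_mul_T l g =>
      have e : C f * T k * (C g * T l) = C (f * g) * (T (k + l) : SymmRing[T;T⁻¹]) := by
        rw [map_mul, T_add]; ring
      rw [e, pDerivLaurent_C_mul_T, pDerivLaurent_C_mul_T, pDerivLaurent_C_mul_T,
        Derivation.leibniz, map_add, smul_eq_mul, smul_eq_mul, map_mul, map_mul, T_add]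
      ring

theorem annihTerm_apply (n : ℕ+) (F : SymmRing[T;T⁻¹]) :
    annihTerm n F = -(T (-(n : ℤ)) + T (n : ℤ)) * pDerivLaurent n F := rfl

theorem annihSum_apply (F : SymmRing[T;T⁻¹]) : annihSum F = ∑ᶠ n, annihTerm n F := rfl

/-- Each term is a derivation multiplied by a Laurent polynomial, and local finiteness lets the
Leibniz rule pass to the sum. -/
theorem annihSum_mul (F G : SymmRing[T;T⁻¹]) :
    annihSum (F * G) = F * annihSum G + annihSum F * G := by
  have hterm : ∀ n, annihTerm n (F * G) = F * annihTerm n G + annihTerm n F * G := by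
    intro n
    rw [annihTerm_apply, annihTerm_apply, annihTerm_apply, pDerivLaurent_mul]
    ring
  rw [annihSum_apply, annihSum_apply, annihSum_apply, mul_finsum' _ _ (annihTerm_finite G),
    finsum_mul' _ _ (annihTerm_finite F), ← finsum_add_distrib]
  · exact finsum_congr hterm
  · refine (annihTerm_finite G).subset fun n hn h0 => hn ?_
    simp only [h0, mul_zero]
  · refine (annihTerm_finite F).subset fun n hn h0 => hn ?_
    simp only [h0, zero_mul]

theorem annihSum_one : annihSum 1 = 0 := by
  have := annihSum_mul 1 1
  simpa using this

theorem annihSum_T (k : ℤ) : annihSum (T k) = 0 := by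
  rw [annihSum_apply]
  refine finsum_eq_zero_of_forall_eq_zero fun n => ?_
  have : (T k : SymmRing[T;T⁻¹]) = C 1 * T k := by simp
  rw [annihTerm_apply, this, pDerivLaurent_C_mul_T]
  simp

theorem annihSum_C_p (n : ℕ+) :
    annihSum (C (p n)) = -(T (-(n : ℤ)) + T (n : ℤ)) := by
  have h : ∀ m, annihTerm m (C (p n)) =
      if m = n then -(T (-(n : ℤ)) + T (n : ℤ)) else 0 := by
    intro m
    have : (C (p n) : SymmRing[T;T⁻¹]) = C (p n) * T 0 := by simp
    rw [annihTerm_apply, this, pDerivLaurent_C_mul_T, pDeriv_p]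
    split_ifs with hmn
    · subst hmn; simp
    · simp
  rw [annihSum_apply, finsum_congr h, finsum_eq_single _ n]
  · simp
  · intro m hm; simp [hm]

theorem annihExp_eq_eval (F : SymmRing[T;T⁻¹]) :
    annihExp F = (expPoly annihSum annihSum_finite F).eval 1 := by
  have := eval_expPoly annihSum annihSum_finite F
  rw [this]; rfl

/-- The exponential series stops after its linear term. This covers 1 and the p_n, whose images
under `annihSum` have coefficients in ℚ and are killed by a second application. -/
theorem annihExp_eq_add_of_annihSum_sq {F : SymmRing[T;T⁻¹]}
    (hF : annihSum (annihSum F) = 0) : annihExp F = F + annihSum F := by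
  have h : ∀ n : ℕ, 2 ≤ n → (annihSum ^ n) F = 0 := by
    intro n hn
    obtain ⟨m, rfl⟩ := Nat.exists_eq_add_of_le' hn
    rw [pow_add, Module.End.mul_apply, pow_two, Module.End.mul_apply, hF, map_zero]
  change ∑ᶠ n : ℕ, ((n.factorial : ℚ)⁻¹ • annihSum ^ n) F = _
  rw [finsum_eq_sum_of_support_subset (s := Finset.range 2)]
  · simp [Finset.sum_range_succ]
  · intro n hn
    by_contra hlt
    apply hn
    change (n.factorial : ℚ)⁻¹ • (annihSum ^ n) F = 0
    rw [h n (by simpa [Nat.succ_le_iff] using hlt), smul_zero]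

/-- The ring homomorphism `f ↦ exp(-∑ (z⁻ⁿ + zⁿ) ∂/∂p_n) f` from `Λ` to `Λ[z, z⁻¹]`. -/
noncomputable def annihHom : SymmRing →+* SymmRing[T;T⁻¹] where
  toFun f := annihExp (C f)
  map_one' := by
    rw [map_one, annihExp_eq_add_of_annihSum_sq] <;> simp [annihSum_one]
  map_mul' f g := by
    rw [map_mul, annihExp_eq_eval, annihExp_eq_eval, annihExp_eq_eval,
      expPoly_mul annihSum_mul, Polynomial.eval_mul]
  map_zero' := by simp
  map_add' f g := by simp

theorem annihHom_apply (f : SymmRing) : annihHom f = annihExp (C f) := rfl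

theorem annihHom_p (n : ℕ+) : annihHom (p n) = C (p n) - T (-(n : ℤ)) - T (n : ℤ) := by
  rw [annihHom_apply, annihExp_eq_add_of_annihSum_sq, annihSum_C_p]
  · ring
  · rw [annihSum_C_p]
    simp [annihSum_T]

/-! ### Newton's identities and the creation factor -/

/-- Uniqueness for F' = QF: coefficient n + 1 of F, times n + 1, is determined by the coefficients
up to n, and n + 1 is a unit in a ℚ-algebra. -/
theorem powerSeries_eq_of_derivative_eq_mul {R : Type*} [CommRing R] [Algebra ℚ R]
    {Q F G : PowerSeries R} (hF : PowerSeries.derivative R F = Q * F)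
    (hG : PowerSeries.derivative R G = Q * G)
    (h0 : PowerSeries.constantCoeff F = PowerSeries.constantCoeff G) : F = G := by
  ext n
  induction n using Nat.strong_induction_on with
  | _ n ih =>
    cases n with
    | zero => simpa using h0
    | succ n =>
      have eF := congrArg (PowerSeries.coeff n) hF
      have eG := congrArg (PowerSeries.coeff n) hG
      rw [PowerSeries.coeff_derivative, PowerSeries.coeff_mul] at eF eG
      have e : PowerSeries.coeff (n + 1) F * ((n : R) + 1) =
          PowerSeries.coeff (n + 1) G * ((n : R) + 1) := by
        rw [eF, eG]
        refine Finset.sum_congr rfl fun x hx => ?_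
        rw [Finset.HasAntidiagonal.mem_antidiagonal] at hx
        rw [ih x.2 (by omega)]
      have hu : IsUnit ((n : R) + 1) := by
        have : IsUnit ((n : ℚ) + 1) := isUnit_iff_ne_zero.2 (by positivity)
        simpa using this.map (algebraMap ℚ R)
      exact hu.mul_right_cancel e

/-- A monomial of degree r + j factors as x_iʳ times a monomial of degree j once for every i whose
exponent is at least r. -/
theorem coeff_p_mul_h (r : ℕ+) (j : ℕ) (m : ℕ →₀ ℕ) :
    MvPowerSeries.coeff m ((p r).1 * (h j).1) =
      if m.degree = r + j then ((m.support.filter fun x => (r : ℕ) ≤ m x).card : ℚ) else 0 := by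
  classical
  have hp : ∀ u, MvPowerSeries.coeff u (p r).1 =
      if ∃ i : ℕ, u = Finsupp.single i (r : ℕ) then 1 else 0 := fun u => rfl
  have hh : ∀ v, MvPowerSeries.coeff v (h j).1 = if v.degree = j then 1 else 0 := by
    intro v
    rw [h, coeff_hsymmSeries]
    simp
  simp only [MvPowerSeries.coeff_mul, hp, hh]
  have hdeg : ∀ x ∈ Finset.HasAntidiagonal.antidiagonal m,
      (if ∃ i : ℕ, x.1 = Finsupp.single i (r : ℕ) then (1 : ℚ) else 0) *
        (if x.2.degree = j then 1 else 0) =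
      if m.degree = r + j then (if ∃ i : ℕ, x.1 = Finsupp.single i (r : ℕ) then (1 : ℚ) else 0)
        else 0 := by
    rintro ⟨u, v⟩ hx
    rw [Finset.HasAntidiagonal.mem_antidiagonal] at hx
    by_cases hu : ∃ i : ℕ, u = Finsupp.single i (r : ℕ)
    · obtain ⟨i, rfl⟩ := hu
      have : m.degree = r + v.degree := by simp [← hx]
      simp [this]
    · simp [hu]
  rw [Finset.sum_congr rfl hdeg]
  split_ifs with hm
  · rw [Finset.sum_boole]
    congr 1
    symm
    refine Finset.card_bij (fun x _ => (Finsupp.single x (r : ℕ), m - Finsupp.single x (r : ℕ)))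
      ?_ ?_ ?_
    · intro x hx
      rw [Finset.mem_filter] at hx ⊢
      refine ⟨?_, x, rfl⟩
      rw [Finset.HasAntidiagonal.mem_antidiagonal]
      exact add_tsub_cancel_of_le (Finsupp.single_le_iff.2 hx.2)
    · intro x _ y _ hxy
      exact Finsupp.single_left_injective r.ne_zero (Prod.ext_iff.1 hxy).1
    · rintro ⟨u, v⟩ hx
      rw [Finset.mem_filter, Finset.HasAntidiagonal.mem_antidiagonal] at hx
      obtain ⟨huv, i, hi⟩ := hx
      simp only at huv hi
      subst hi
      have hr := r.pos
      refine ⟨i, ?_, ?_⟩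
      · rw [Finset.mem_filter, Finsupp.mem_support_iff, ← huv]
        simp
      · rw [← huv]
        simp
  · simp

/-- The generating series `∑ h_n zⁿ` of the complete homogeneous symmetric functions. -/
noncomputable def hSeries : PowerSeries SymmRing := PowerSeries.mk fun n => h n

/-- The generating series `∑ p_{n+1} zⁿ` of the power sums. -/
noncomputable def pSeries : PowerSeries SymmRing := PowerSeries.mk fun n => p n.succPNat

theorem h_zero : h 0 = 1 := by
  classical
  apply Subtype.ext
  ext m
  rw [h, coeff_hsymmSeries, OneMemClass.coe_one, MvPowerSeries.coeff_one]
  simp [Finsupp.degree_eq_zero_iff]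

theorem h_of_neg {k : ℤ} (hk : k < 0) : h k = 0 := by
  apply Subtype.ext
  ext m
  rw [h, coeff_hsymmSeries, if_neg (by omega)]
  rfl

theorem constantCoeff_hSeries : PowerSeries.constantCoeff hSeries = 1 := by
  rw [← PowerSeries.coeff_zero_eq_constantCoeff_apply, hSeries, PowerSeries.coeff_mk]
  exact h_zero

theorem sum_card_filter_lt (s : Finset ℕ) (m : ℕ → ℕ) (N : ℕ) (hN : ∀ x ∈ s, m x ≤ N) :
    ∑ r ∈ Finset.range N, (s.filter fun x => r + 1 ≤ m x).card = ∑ x ∈ s, m x := by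
  simp only [Finset.card_filter]
  rw [Finset.sum_comm]
  refine Finset.sum_congr rfl fun x hx => ?_
  rw [← Finset.card_filter]
  have : (Finset.range N).filter (fun r => r + 1 ≤ m x) = Finset.range (m x) := by
    ext r
    have := hN x hx
    simp only [Finset.mem_filter, Finset.mem_range]
    omega
  rw [this, Finset.card_range]

/-- Newton's identity. In each monomial of degree n + 1, counting the variables with exponent at
least r and summing over r ≥ 1 gives the total degree n + 1. -/
theorem sum_p_mul_h (n : ℕ) :
    ∑ x ∈ Finset.HasAntidiagonal.antidiagonal n, p x.1.succPNat * h x.2 =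
      h (n + 1 : ℕ) * ((n : SymmRing) + 1) := by
  classical
  apply Subtype.ext
  ext m
  have e : h (n + 1 : ℕ) * ((n : SymmRing) + 1) = ((n : ℚ) + 1) • h (n + 1 : ℕ) := by
    rw [Algebra.smul_def, mul_comm]
    simp
  rw [e, AddSubmonoidClass.coe_finsetSum, map_sum]
  have hr : MvPowerSeries.coeff m ((((n : ℚ) + 1) • h (n + 1 : ℕ) : SymmRing)).1 =
      ((n : ℚ) + 1) * if m.degree = n + 1 then 1 else 0 := by
    change MvPowerSeries.coeff m (((n : ℚ) + 1) • (h (n + 1 : ℕ)).1) = _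
    rw [map_smul, smul_eq_mul, h, coeff_hsymmSeries]
    norm_cast
  have hl : ∀ x ∈ Finset.HasAntidiagonal.antidiagonal n,
      MvPowerSeries.coeff m (p x.1.succPNat * h x.2 : SymmRing).1 =
      if m.degree = n + 1 then
        ((m.support.filter fun y => x.1 + 1 ≤ m y).card : ℚ) else 0 := by
    intro x hx
    rw [Finset.HasAntidiagonal.mem_antidiagonal] at hx
    have e : (x.1.succPNat : ℕ) + x.2 = n + 1 := by
      rw [Nat.succPNat_coe]; omega
    change MvPowerSeries.coeff m ((p x.1.succPNat).1 * (h x.2).1) = _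
    rw [coeff_p_mul_h, e]
    rfl
  rw [hr, Finset.sum_congr rfl hl]
  split_ifs with hm
  · rw [Finset.Nat.sum_antidiagonal_eq_sum_range_succ_mk, mul_one, ← Nat.cast_sum,
      sum_card_filter_lt]
    · rw [← Finsupp.degree_apply, hm]
      push_cast
      rfl
    · intro x _
      rw [Nat.succ_eq_add_one, ← hm]
      exact Finsupp.le_degree x m
  · simp

theorem derivative_hSeries :
    PowerSeries.derivative SymmRing hSeries = pSeries * hSeries := by
  ext1 n
  rw [PowerSeries.coeff_derivative, PowerSeries.coeff_mul]
  simp only [hSeries, pSeries, PowerSeries.coeff_mk]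
  exact (sum_p_mul_h n).symm

theorem derivative_creationSum :
    PowerSeries.derivative SymmRing creationSum = pSeries := by
  ext1 n
  rw [PowerSeries.coeff_derivative, creationSum, pSeries, PowerSeries.coeff_mk,
    PowerSeries.coeff_mk, dif_pos n.succ_pos]
  have : ((n : SymmRing) + 1) = algebraMap ℚ SymmRing ((n + 1 : ℕ) : ℚ) := by simp
  rw [this, mul_comm, ← Algebra.smul_def, smul_smul, mul_inv_cancel₀ (by positivity), one_smul]
  rfl

/-- Moves the exponential series from ℚ to Λ as coefficient ring, so that the chain rule for the
derivation over Λ applies. -/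
theorem creationExp_eq_subst_exp :
    creationExp = (PowerSeries.exp SymmRing).subst creationSum := by
  ext1 n
  rw [creationExp, PowerSeries.coeff_subst' hasSubst_creationSum,
    PowerSeries.coeff_subst' hasSubst_creationSum]
  refine finsum_congr fun d => ?_
  rw [PowerSeries.coeff_exp, PowerSeries.coeff_exp, algebraMap_smul, algebraMap_smul]

theorem derivative_creationExp :
    PowerSeries.derivative SymmRing creationExp = pSeries * creationExp := by
  rw [creationExp_eq_subst_exp, PowerSeries.derivative_subst hasSubst_creationSum,
    PowerSeries.derivative_exp, derivative_creationSum, mul_comm]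

theorem constantCoeff_creationExp : PowerSeries.constantCoeff creationExp = 1 := by
  rw [creationExp, ← PowerSeries.coeff_zero_eq_constantCoeff_apply,
    PowerSeries.coeff_subst' hasSubst_creationSum, finsum_eq_single _ 0]
  · simp
  · intro d hd
    have : PowerSeries.constantCoeff creationSum = 0 := by
      simp [creationSum, ← PowerSeries.coeff_zero_eq_constantCoeff_apply]
    simp [this, hd]

theorem creationExp_eq : creationExp = hSeries :=
  powerSeries_eq_of_derivative_eq_mul derivative_creationExp derivative_hSeries
    (by rw [constantCoeff_creationExp, constantCoeff_hSeries])

theorem creationCoeff_eq (j : ℤ) : creationCoeff j = h j := by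
  rw [creationCoeff]
  split_ifs with hj
  · rw [creationExp_eq, hSeries, PowerSeries.coeff_mk, Int.toNat_of_nonneg hj]
  · rw [h_of_neg (by omega)]

/-! ### Image of the complete homogeneous functions under the homomorphism -/

theorem derivative_map {R S : Type*} [CommRing R] [CommRing S] (f : R →+* S)
    (F : PowerSeries R) : PowerSeries.derivative S (PowerSeries.map f F) =
      PowerSeries.map f (PowerSeries.derivative R F) := by
  ext n
  simp [PowerSeries.coeff_derivative]

section GeneratingSeries

variable {A B : Type*} [CommRing A] [CommRing B]

/-- The geometric series t/(1 - tX) with its denominator cleared; it is minus the logarithmic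
derivative of 1 - tX. -/
theorem mk_pow_succ_mul_one_sub (t : B) :
    (PowerSeries.mk fun n => t ^ (n + 1)) * (1 - PowerSeries.C t * PowerSeries.X) =
      PowerSeries.C t := by
  ext n
  rw [mul_sub, mul_one, mul_left_comm, map_sub, PowerSeries.coeff_C_mul, PowerSeries.coeff_C]
  cases n with
  | zero => simp
  | succ n =>
    rw [PowerSeries.coeff_succ_mul_X, PowerSeries.coeff_mk, PowerSeries.coeff_mk,
      if_neg n.succ_ne_zero, sub_eq_zero, pow_succ']

/-- P is the logarithmic derivative of H. The hypothesis on P says that f changes it by the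
logarithmic derivative of (1 - tX)(1 - sX), so both sides solve the same equation with constant term
1. -/
theorem map_eq_mul_map_of_derivative_eq_mul [Algebra ℚ B] (f g : A →+* B) (t s : B)
    {P H : PowerSeries A} (hH : PowerSeries.derivative A H = P * H)
    (h0 : PowerSeries.constantCoeff H = 1)
    (hP : ∀ n, f (PowerSeries.coeff n P) = g (PowerSeries.coeff n P) - t ^ (n + 1) - s ^ (n + 1)) :
    PowerSeries.map f H = (1 - PowerSeries.C t * PowerSeries.X) *
      (1 - PowerSeries.C s * PowerSeries.X) * PowerSeries.map g H := by
  have hmap : PowerSeries.map f P = PowerSeries.map g P -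
      (PowerSeries.mk fun n => t ^ (n + 1)) - PowerSeries.mk fun n => s ^ (n + 1) := by
    ext n
    simpa using hP n
  refine powerSeries_eq_of_derivative_eq_mul (Q := PowerSeries.map f P) ?_ ?_ ?_
  · rw [derivative_map, hH, map_mul]
  · have hd : ∀ k : B, PowerSeries.derivative B
        (1 - PowerSeries.C k * PowerSeries.X) = -PowerSeries.C k := by
      intro k
      simp [Derivation.leibniz]
    rw [Derivation.leibniz, Derivation.leibniz, hd, hd, derivative_map, hH, hmap, map_mul]
    simp only [smul_eq_mul]
    linear_combination ((1 - PowerSeries.C s * PowerSeries.X) *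
      PowerSeries.map g H) * mk_pow_succ_mul_one_sub t +
      ((1 - PowerSeries.C t * PowerSeries.X) * PowerSeries.map g H) * mk_pow_succ_mul_one_sub s
  · have h1 : ∀ f : A →+* B, PowerSeries.constantCoeff (PowerSeries.map f H) = 1 := by
      intro f
      rw [← PowerSeries.coeff_zero_eq_constantCoeff_apply, PowerSeries.coeff_map,
        PowerSeries.coeff_zero_eq_constantCoeff_apply, h0, map_one]
    rw [map_mul, h1, h1]
    simp

theorem map_coeff_of_derivative_eq_mul [Algebra ℚ B] (f g : A →+* B) {t s : B} (hts : t * s = 1)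
    {P : PowerSeries A} {c : ℤ → A} (hneg : ∀ k < 0, c k = 0) (h0 : c 0 = 1)
    (hc : PowerSeries.derivative A (PowerSeries.mk fun n => c n) =
      P * PowerSeries.mk fun n => c n)
    (hP : ∀ n, f (PowerSeries.coeff n P) = g (PowerSeries.coeff n P) - t ^ (n + 1) - s ^ (n + 1))
    (k : ℤ) : f (c k) = g (c k) - (t + s) * g (c (k - 1)) + g (c (k - 2)) := by
  set H : PowerSeries A := PowerSeries.mk fun n => c n with hH
  have e : PowerSeries.map f H = PowerSeries.map g H -
      PowerSeries.C (t + s) * (PowerSeries.map g H * PowerSeries.X) +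
      PowerSeries.map g H * PowerSeries.X * PowerSeries.X := by
    rw [map_eq_mul_map_of_derivative_eq_mul f g t s hc (by simp [hH, h0,
      ← PowerSeries.coeff_zero_eq_constantCoeff_apply]) hP, map_add]
    -- Since ts = 1, the quadratic factor is 1 - (t + s)X + X².
    have := congrArg (PowerSeries.C (R := B)) hts
    rw [map_mul, map_one] at this
    linear_combination (PowerSeries.X * PowerSeries.X * PowerSeries.map g H) * this
  rcases lt_or_ge k 0 with hk | hk
  · rw [hneg k hk, hneg (k - 1) (by omega), hneg (k - 2) (by omega)]
    simp
  · obtain ⟨n, rfl⟩ := Int.eq_ofNat_of_zero_le hk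
    have := congrArg (PowerSeries.coeff n) e
    rw [map_add, map_sub, PowerSeries.coeff_C_mul, PowerSeries.coeff_map, PowerSeries.coeff_map]
      at this
    have hc : ∀ i : ℕ, PowerSeries.coeff i H = c i := fun i => PowerSeries.coeff_mk _ _
    rw [hc] at this
    rw [this]
    -- For n = 0 and n = 1 the terms with negative index vanish on both sides.
    match n with
    | 0 => simp [hneg]
    | 1 =>
      rw [show (1 : ℕ) = 0 + 1 from rfl, PowerSeries.coeff_succ_mul_X,
        PowerSeries.coeff_succ_mul_X, PowerSeries.coeff_map, hc]
      simp [hneg]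
    | n + 2 =>
      rw [PowerSeries.coeff_succ_mul_X, PowerSeries.coeff_succ_mul_X, PowerSeries.coeff_succ_mul_X,
        PowerSeries.coeff_map, PowerSeries.coeff_map, hc, hc,
        show ((n + 1 : ℕ) : ℤ) = (n + 2 : ℕ) - 1 by push_cast; ring,
        show (n : ℤ) = (n + 2 : ℕ) - 2 by push_cast; ring]

end GeneratingSeries

theorem annihHom_h (k : ℤ) : annihHom (h k) =
    C (h k) - (T 1 + T (-1)) * C (h (k - 1)) + C (h (k - 2)) := by
  have hT : (T 1 * T (-1) : SymmRing[T;T⁻¹]) = 1 := by rw [← T_add]; simp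
  have hP : ∀ n, annihHom (PowerSeries.coeff n pSeries) =
      C (PowerSeries.coeff n pSeries) - T 1 ^ (n + 1) - T (-1) ^ (n + 1) := by
    intro n
    rw [pSeries, PowerSeries.coeff_mk, annihHom_p, T_pow, T_pow, mul_one, mul_neg_one,
      Nat.succPNat_coe, Nat.succ_eq_add_one]
    ring
  exact map_coeff_of_derivative_eq_mul annihHom C hT (fun k hk => h_of_neg hk) h_zero
    derivative_hSeries hP k

/-! ### Coefficient extraction -/

/-- The coefficient of `z^a` in `h(z) F`, where `h(z) = ∑ h_n zⁿ`. -/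
noncomputable def hConv (a : ℤ) : SymmRing[T;T⁻¹] →+ SymmRing where
  toFun F := F.coeff.sum fun m g => h (a - m) * g
  map_zero' := by simp
  map_add' F G := by
    rw [AddMonoidAlgebra.coeff_add]
    exact Finsupp.sum_add_index' (fun _ => mul_zero _) fun _ _ _ => mul_add _ _ _

theorem hConv_C_mul_T (a : ℤ) (g : SymmRing) (m : ℤ) : hConv a (C g * T m) = h (a - m) * g := by
  rw [← single_eq_C_mul_T]
  change (AddMonoidAlgebra.single m g).coeff.sum (fun m g => h (a - m) * g) = _
  rw [AddMonoidAlgebra.coeff_single, Finsupp.sum_single_index (mul_zero _)]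

theorem Y_apply (a : ℤ) (f : SymmRing) : Y (-a) f = hConv a (annihHom f) := by
  change (annihExp (C f)).coeff.sum (fun m g => creationCoeff (- -a - m) * g) =
    (annihExp (C f)).coeff.sum (fun m g => h (a - m) * g)
  simp only [creationCoeff_eq, neg_neg]

/-! ### Column operations and bordered determinants -/

section ColumnOperations

variable {B : Type*} [CommRing B]

/-- The matrix of the column operations turning the columns `v 0, v 1, v 2, …` into
`v 0, v 1 + v (-1) - u v 0, v 2 + v 0 - u v 1, …`, where `v (-1) = v 1`. -/
def colOpMatrix (u : B) (n : ℕ) : Matrix (Fin (n + 2)) (Fin (n + 2)) B :=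
  Matrix.of fun l c => Fin.cases (if (l : ℤ) = 0 then 1 else 0)
    (fun j : Fin (n + 1) => (if (l : ℤ) = j + 1 then 1 else 0) +
      (if (l : ℤ) = |(j : ℤ) - 1| then 1 else 0) - (if (l : ℤ) = j then u else 0)) c

/-- The matrix is upper triangular with diagonal 1, 2, 1, 1, …. The 2 arises because v (-1) = v 1
makes the column with index 1 equal to 2 v 1 - u v 0; the absolute value in the definition encodes
this reflection. -/
theorem det_colOpMatrix (u : B) (n : ℕ) : (colOpMatrix u n).det = 2 := by
  rw [Matrix.det_of_isUpperTriangular, Fin.prod_univ_succ, Fin.prod_univ_succ,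
    Finset.prod_eq_one]
  · simp only [colOpMatrix, Matrix.of_apply, Fin.cases_zero, Fin.cases_succ, Fin.val_zero,
      Fin.val_succ]
    norm_num
  · intro j _
    simp only [colOpMatrix, Matrix.of_apply, Fin.cases_succ, Fin.val_succ]
    push_cast
    rw [if_pos rfl, if_neg (by rw [add_sub_cancel_right, abs_of_nonneg] <;> omega),
      if_neg (by omega)]
    simp
  · intro l c hlc
    have hlt : c < l := hlc
    induction c using Fin.cases with
    | zero =>
      have : l ≠ 0 := hlt.ne'
      simp [colOpMatrix, this]
    | succ j =>
      have : (j : ℕ) + 1 < l := by simpa [Fin.lt_def] using hlt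
      simp only [colOpMatrix, Matrix.of_apply, Fin.cases_succ]
      rw [if_neg (by omega), if_neg (by rcases abs_cases ((j : ℤ) - 1) with h | h <;> omega),
        if_neg (by omega)]
      simp

theorem sum_mul_ite_val_eq {N : ℕ} (f : ℤ → B) (b : B) {m : ℤ} (h0 : 0 ≤ m) (h1 : m < N) :
    ∑ l : Fin N, f l * (if (l : ℤ) = m then b else 0) = f m * b := by
  obtain ⟨m, rfl⟩ := Int.eq_ofNat_of_zero_le h0
  rw [Finset.sum_eq_single ⟨m, by omega⟩]
  · simp
  · intro l _ hl
    rw [if_neg, mul_zero]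
    intro h
    exact hl (Fin.ext (by exact_mod_cast h))
  · simp

/-- Multiplying by `colOpMatrix` contributes the 2 on the left. It reduces the top row to (2, 0, 0,
…), whose expansion contributes the 2 on the right. -/
theorem two_mul_det_eq_of_even (u : B) {n : ℕ} (v : Fin (n + 2) → ℤ → B)
    (heven : ∀ i, v i (-1) = v i 1) (h0 : v 0 0 = 2)
    (hrec : ∀ j : ℤ, v 0 (j + 1) + v 0 (j - 1) = u * v 0 j) :
    2 * (Matrix.of fun i j : Fin (n + 2) => v i j).det =
      2 * (Matrix.of fun i j : Fin (n + 1) =>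
        v i.succ (j + 1) + v i.succ (j - 1) - u * v i.succ j).det := by
  have key : (Matrix.of fun i j : Fin (n + 2) => v i j) * colOpMatrix u n =
      Matrix.of fun i => Fin.cases (v i 0)
        fun j : Fin (n + 1) => v i (j + 1) + v i (j - 1) - u * v i j := by
    ext i c
    rw [Matrix.mul_apply]
    induction c using Fin.cases with
    | zero =>
      simp only [Matrix.of_apply, colOpMatrix, Fin.cases_zero]
      rw [sum_mul_ite_val_eq (v i) 1 le_rfl (by omega), mul_one]
    | succ j =>
      have hj := j.2
      simp only [Matrix.of_apply, colOpMatrix, Fin.cases_succ, mul_add, mul_sub,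
        Finset.sum_add_distrib, Finset.sum_sub_distrib]
      rw [sum_mul_ite_val_eq (v i) 1 (by omega) (by omega),
        sum_mul_ite_val_eq (v i) 1 (abs_nonneg _)
          (by rcases abs_cases ((j : ℤ) - 1) with h | h <;> omega),
        sum_mul_ite_val_eq (v i) u (by omega) (by omega), mul_one, mul_one, mul_comm u]
      congr 2
      -- Only at j = 0 does j - 1 leave the range of columns; evenness then replaces v (-1) by v 1.
      rcases Nat.eq_zero_or_pos (j : ℕ) with h | h
      · simp [h, heven]
      · rw [abs_of_nonneg (by omega)]
  rw [← det_colOpMatrix u n, mul_comm, ← Matrix.det_mul, key, Matrix.det_succ_row_zero,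
    Fin.sum_univ_succ, Finset.sum_eq_zero, det_colOpMatrix]
  · simp only [Fin.val_zero, pow_zero, Matrix.of_apply, Fin.cases_zero, h0, one_mul, add_zero]
    congr 2
  · intro j _
    simp [hrec]

variable {A : Type*} [CommRing A]

/-- The matrix `(c_{λ_i - i + j} + c_{λ_i - i - j})`, with indices starting from zero. -/
def symplecticMatrix (c : ℤ → A) {n : ℕ} (lam : Fin n → ℤ) : Matrix (Fin n) (Fin n) A :=
  Matrix.of fun i j => c (lam i - i + j) + c (lam i - i - j)

/-- The right side is the bordered determinant with top row t, expanded along that row. The entry a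
occurs only in the row that the minors omit; it is present so that these are literally the minors of
the larger symplectic matrix. -/
theorem map_det_symplecticMatrix [Algebra ℚ B] (f g : A →+* B) {u : B} {c : ℤ → A}
    (hc : ∀ k, f (c k) = g (c k) - u * g (c (k - 1)) + g (c (k - 2))) {t : ℤ → B}
    (heven : t (-1) = t 1) (h0 : t 0 = 2) (hrec : ∀ j, t (j + 1) + t (j - 1) = u * t j)
    {n : ℕ} (a : ℤ) (lam : Fin (n + 1) → ℤ) :
    f (symplecticMatrix c lam).det = ∑ j : Fin (n + 2), (-1) ^ (j : ℕ) * t j *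
      g ((symplecticMatrix c (Fin.cons a lam : Fin (n + 2) → ℤ)).submatrix
        Fin.succ j.succAbove).det := by
  -- Row i of the small matrix becomes row i + 1 below the border, hence the shift to `lam i - (i +
  -- 1)`; this shift centres the three-term relation `hc` at column j.
  let v : Fin (n + 2) → ℤ → B := fun i j =>
    Fin.cases (t j) (fun i => g (c (lam i - (i + 1) + j) + c (lam i - (i + 1) - j))) i
  have h2 : IsUnit (2 : B) := by
    have : IsUnit (2 : ℚ) := isUnit_iff_ne_zero.2 two_ne_zero
    simpa only [map_ofNat] using this.map (algebraMap ℚ B)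
  have key := two_mul_det_eq_of_even u v ?_ h0 hrec
  · have e : f (symplecticMatrix c lam).det =
        (Matrix.of fun i j : Fin (n + 2) => v i j).det := by
      refine Eq.trans ?_ (h2.mul_left_cancel key).symm
      rw [RingHom.map_det]
      congr 1
      ext1 i j
      simp only [RingHom.mapMatrix_apply, Matrix.map_apply, symplecticMatrix, Matrix.of_apply, v,
        Fin.cases_succ, map_add, hc]
      ring_nf
    rw [e, Matrix.det_succ_row_zero]
    refine Finset.sum_congr rfl fun j _ => ?_
    rw [RingHom.map_det]
    congr 2
  · intro i
    induction i using Fin.cases with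
    | zero => exact heven
    | succ i => simp only [v, Fin.cases_succ, ← sub_eq_add_neg, sub_neg_eq_add, add_comm]

end ColumnOperations

/-! ### Adding a row, and induction on the number of rows -/

theorem annihHom_det_symplecticMatrix {n : ℕ} (a : ℤ) (lam : Fin (n + 1) → ℤ) :
    annihHom (symplecticMatrix h lam).det =
      ∑ j : Fin (n + 2), (-1) ^ (j : ℕ) * (T (j : ℤ) + T (-(j : ℤ))) *
        C ((symplecticMatrix h (Fin.cons a lam : Fin (n + 2) → ℤ)).submatrix
          Fin.succ j.succAbove).det := by
  have heven : (T (-1) + T (- -1) : SymmRing[T;T⁻¹]) = T 1 + T (-1) := by rw [neg_neg]; ring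
  have h0 : (T 0 + T (-0) : SymmRing[T;T⁻¹]) = 2 := by
    rw [neg_zero, T_zero]; norm_num
  have hrec : ∀ j : ℤ, (T (j + 1) + T (-(j + 1)) + (T (j - 1) + T (-(j - 1))) : SymmRing[T;T⁻¹]) =
      (T 1 + T (-1)) * (T j + T (-j)) := by
    intro j
    rw [add_mul, mul_add, mul_add, ← T_add, ← T_add, ← T_add, ← T_add,
      show -(j + 1) = -1 + -j by ring, show -(j - 1) = 1 + -j by ring, add_comm j 1,
      show j - 1 = -1 + j by ring]
    ring
  exact map_det_symplecticMatrix annihHom C annihHom_h (t := fun j => T j + T (-j)) heven h0 hrec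
    a lam

/-- The coefficient of z^a in H(z)(z^j + z^{-j}) is h_{a-j} + h_{a+j}, the top-row entry in column
j. Both sides are therefore the same expansion along the top row. -/
theorem Y_det_symplecticMatrix {n : ℕ} (a : ℤ) (lam : Fin (n + 1) → ℤ) :
    Y (-a) (symplecticMatrix h lam).det =
      (symplecticMatrix h (Fin.cons a lam : Fin (n + 2) → ℤ)).det := by
  rw [Y_apply, annihHom_det_symplecticMatrix a lam, Matrix.det_succ_row_zero, map_sum]
  refine Finset.sum_congr rfl fun j _ => ?_
  generalize ((symplecticMatrix h (Fin.cons a lam : Fin (n + 2) → ℤ)).submatrix Fin.succ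
    j.succAbove).det = g
  have e : ((-1) ^ (j : ℕ) * (T (j : ℤ) + T (-(j : ℤ))) * C g : SymmRing[T;T⁻¹]) =
      C ((-1) ^ (j : ℕ) * g) * T (j : ℤ) + C ((-1) ^ (j : ℕ) * g) * T (-(j : ℤ)) := by
    rw [map_mul, map_pow, map_neg, map_one]
    ring
  simp only [Matrix.of_apply, symplecticMatrix, Fin.cons_zero, Fin.val_zero]
  rw [e, map_add, hConv_C_mul_T, hConv_C_mul_T]
  push_cast
  simp only [sub_zero, sub_neg_eq_add]
  ring

theorem Y_one (a : ℤ) : Y (-a) 1 = h a := by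
  have := hConv_C_mul_T a 1 0
  rw [Y_apply, map_one]
  simpa using this

theorem prod_Y_one {n : ℕ} (lam : Fin (n + 1) → ℤ) :
    (List.ofFn fun i => Y (-lam i)).prod 1 = (1 / 2 : ℚ) • (symplecticMatrix h lam).det := by
  induction n with
  | zero =>
    -- The 1 × 1 determinant is h_a + h_a, which accounts for the factor 1/2.
    simp only [List.ofFn_succ, List.ofFn_zero, List.prod_singleton, Y_one, symplecticMatrix]
    simp [← two_smul ℚ, smul_smul]
  | succ n ih =>
    rw [List.ofFn_succ, List.prod_cons, Module.End.mul_apply, ih fun i => lam i.succ, map_smul,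
      Y_det_symplecticMatrix]
    congr 3
    exact Fin.cons_self_tail lam

end SymmFun

theorem theoremT {k : ℕ} (hk : 0 < k) (lam : Fin k → ℕ) (hlam : Antitone lam) :
    (List.ofFn fun i : Fin k => SymmFun.Y (-(lam i : ℤ))).prod 1 = SymmFun.symplecticSchur lam := by
  obtain ⟨n, rfl⟩ := Nat.exists_eq_succ_of_ne_zero hk.ne'
  rw [SymmFun.prod_Y_one fun i => (lam i : ℤ), SymmFun.symplecticSchur]
  congr 2
  ext1 i j
  simp only [SymmFun.symplecticMatrix, Matrix.of_apply]
  -- With indices from zero, the + 2 of the second summand cancels the two shifts by one.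
  congr 2 <;> ring
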